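/- Let $H$ be a real Hilbert space, $A:H\to H$ an injective (everywhere defined) linear operator, and $R:H\to H$ an injective bounded positive self-adjoint operator. Let $\xi$ be a (generalized) Gaussian random vector in $H$ with $E\xi=0$ and covariance operator $R$, that is, a family of jointly Gaussian centred random variables $\langle\xi,h\rangle$, $h\in H$, with $E\langle\xi,g\rangle\langle\xi,h\rangle=\langle Rg,h\rangle$. For $\epsilon>0$ one observes $Y=Ax+\epsilon\xi$, that is, the family $\langle Y,h\rangle=\langle Ax,h\rangle+\epsilon\langle\xi,h\rangle$, $h\in H$, where $x$ is an unknown element of a closed linear subspace $\Theta\subset H$. Let $\Theta_0,\Theta_1\subset\Theta$; the hypothesis is $H_0:x\in\Theta_0$ and the alternative is $H_1:x\in\Theta_1$. A test $K$ is a measurable function of $Y$ with values in $[0,1]$; let $\alpha_\epsilon(K)=\sup_{x\in\Theta_0}E_xK(Y)$ and $\beta_\epsilon(K)=\sup_{x\in\Theta_1}E_x(1-K(Y))$ (with $\sup\emptyset=0$), where $E_x$ is the expectation when $Y=Ax+\epsilon\xi$. $H_0$ and $H_1$ are called *distinguishable* if for every $\alpha\in(0,1)$ there are tests $K_\epsilon$,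 $\epsilon>0$, with $\alpha_\epsilon(K_\epsilon)<\alpha$ for all $\epsilon>0$ and $\beta_\epsilon(K_\epsilon)\to0$ as $\epsilon\to0$. They are called *indistinguishable* if $\alpha_\epsilon(K)+\beta_\epsilon(K)\ge1$ for every $\epsilon>0$ and every test $K$. Suppose that $A\Theta_0$ and $A\Theta_1$ lie in the range of $R^{1/2}$ and put $\Lambda_i=R^{-1/2}A\Theta_i$, $i=0,1$. Let $\Lambda$ be the closed linear span of $\Lambda_0\cup\Lambda_1$, let $\bar\Lambda_i$ be the closure of $\Lambda_i$ in the weak topology of $H$, and let $\Pi_\Gamma$ be the orthogonal projection onto a finite-dimensional subspace $\Gamma$. **Theorem.** Let $\Lambda_0$ and $\Lambda_1$ be bounded in $H$. Then $H_0$ and $H_1$ are (i) indistinguishable if there is no finite-dimensional linear subspace $\Gamma\subset\Lambda$ such that $\Pi_\Gamma\bar\Lambda_0\cap\Pi_\Gamma\bar\Lambda_1=\emptyset$; (ii) distinguishable if there is a finite-dimensional linear subspace $\Gamma\subset\Lambda$ such that $\Pi_\Gamma\bar\Lambda_0\cap\Pi_\Gamma\bar\Lambda_1=\emptyset$. -/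

import Mathlib

open MeasureTheory ProbabilityTheory Filter Topology
open scoped RealInnerProductSpace

section SquareRoot

variable {H : Type*} [NormedAddCommGroup H] [InnerProductSpace ℝ H] [CompleteSpace H]

/-- If `T` is self-adjoint with `‖T‖ ≤ 1`, then `Z = (T + Z ^ 2) / 2` has a self-adjoint solution
with `‖Z‖ ≤ 1`, so that `(1 - Z) ^ 2 = 1 - T`. -/
theorem exists_fixedPoint_of_norm_le_one {E : Type*} [NormedRing E] [NormedAlgebra ℝ E]
    [CompleteSpace E] [StarRing E] [ContinuousStar E] [StarModule ℝ E]
    (T : E) (hTnorm : ‖T‖ ≤ 1) (hTsa : IsSelfAdjoint T) :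
    ∃ Z : E, Z = (2⁻¹ : ℝ) • (T + Z * Z) ∧ ‖Z‖ ≤ 1 ∧ IsSelfAdjoint Z := by
  obtain ⟨Y, hY0, hY⟩ : ∃ Y : ℕ → E, Y 0 = 0 ∧
      ∀ n, Y (n + 1) = (2⁻¹ : ℝ) • (T + Y n * Y n) :=
    ⟨fun n => Nat.rec 0 (fun _ Z => (2⁻¹ : ℝ) • (T + Z * Z)) n, rfl, fun _ => rfl⟩
  obtain ⟨y, hy00, hy⟩ : ∃ y : ℕ → ℝ, y 0 = 0 ∧ ∀ n, y (n + 1) = 2⁻¹ * (1 + y n * y n) :=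
    ⟨fun n => Nat.rec 0 (fun _ z => 2⁻¹ * (1 + z * z)) n, rfl, fun _ => rfl⟩
  have hy0 : ∀ n, 0 ≤ y n ∧ y n ≤ 1 := by
    intro n
    induction n with
    | zero => simp [hy00]
    | succ n ih => rw [hy]; constructor <;> nlinarith
  have hYy : ∀ n, ‖Y n‖ ≤ y n := by
    intro n
    induction n with
    | zero => simp [hY0, hy00]
    | succ n ih =>
      rw [hY, hy, norm_smul, Real.norm_of_nonneg (by norm_num)]
      gcongr
      calc ‖T + Y n * Y n‖ ≤ ‖T‖ + ‖Y n‖ * ‖Y n‖ :=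
            (norm_add_le _ _).trans (by gcongr; exact norm_mul_le _ _)
        _ ≤ 1 + y n * y n := by gcongr; exact (hy0 n).1
  have hdiff : ∀ n, ‖Y (n + 1) - Y n‖ ≤ y (n + 1) - y n := by
    intro n
    induction n with
    | zero =>
      have : ‖Y 1‖ ≤ y 1 := hYy 1
      simpa [hY0, hy00] using this
    | succ n ih =>
      have e : Y (n + 1 + 1) - Y (n + 1)
          = (2⁻¹ : ℝ) • (Y (n + 1) * (Y (n + 1) - Y n) + (Y (n + 1) - Y n) * Y n) := by
        rw [hY (n + 1), hY n, ← smul_sub]; congr 1; noncomm_ring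
      have e' : y (n + 1 + 1) - y (n + 1)
          = 2⁻¹ * (y (n + 1) * (y (n + 1) - y n) + (y (n + 1) - y n) * y n) := by
        linear_combination hy (n + 1) - hy n
      rw [e, e', norm_smul, Real.norm_of_nonneg (by norm_num)]
      gcongr
      refine (norm_add_le _ _).trans ?_
      have hd : 0 ≤ y (n + 1) - y n := (norm_nonneg _).trans ih
      refine add_le_add ((norm_mul_le _ _).trans ?_) ((norm_mul_le _ _).trans ?_)
      · exact mul_le_mul (hYy _) ih (norm_nonneg _) (hy0 _).1
      · exact mul_le_mul ih (hYy _) (norm_nonneg _) hd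
  have hsum : Summable fun n => y (n + 1) - y n := by
    refine summable_of_sum_range_le (c := 1) (fun n => (norm_nonneg _).trans (hdiff n)) fun n => ?_
    rw [Finset.sum_range_sub]
    have := (hy0 n).2
    simpa [hy00] using this
  have hcauchy : CauchySeq Y := by
    refine cauchySeq_of_dist_le_of_summable _ (fun n => ?_) hsum
    rw [dist_comm, dist_eq_norm]
    exact hdiff n
  obtain ⟨Z, hZ⟩ := cauchySeq_tendsto_of_complete hcauchy
  have hZeq : Z = (2⁻¹ : ℝ) • (T + Z * Z) := by
    have h1 : Tendsto (fun n => Y (n + 1)) atTop (𝓝 Z) := (tendsto_add_atTop_iff_nat 1).mpr hZ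
    simp only [hY] at h1
    exact tendsto_nhds_unique h1 ((tendsto_const_nhds.add (hZ.mul hZ)).const_smul (2⁻¹ : ℝ))
  have hYsa : ∀ n, IsSelfAdjoint (Y n) := by
    intro n
    induction n with
    | zero => rw [hY0]; exact IsSelfAdjoint.zero _
    | succ n ih =>
      rw [hY]
      refine IsSelfAdjoint.smul (by simp) (hTsa.add ?_)
      rw [IsSelfAdjoint, star_mul, ih.star_eq]
  have hZsa : IsSelfAdjoint Z := by
    have h1 : Tendsto (fun n => star (Y n)) atTop (𝓝 (star Z)) := hZ.star
    simp only [(hYsa _).star_eq] at h1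
    exact tendsto_nhds_unique h1 hZ
  have hZnorm : ‖Z‖ ≤ 1 := le_of_tendsto hZ.norm (Eventually.of_forall fun n =>
    (hYy n).trans (hy0 n).2)
  exact ⟨Z, hZeq, hZnorm, hZsa⟩

/-- A bounded positive operator on a real Hilbert space has a bounded positive square root. -/
theorem exists_isPositive_mul_self_eq (R : H →L[ℝ] H) (hR : R.IsPositive) :
    ∃ S : H →L[ℝ] H, S.IsPositive ∧ S * S = R := by
  by_cases hR0 : R = 0
  · exact ⟨0, ContinuousLinearMap.isPositive_zero, by simp [hR0]⟩
  have hc : 0 < ‖R‖ := norm_pos_iff.mpr hR0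
  set c : ℝ := ‖R‖ with hcdef
  have hsym : ∀ x y, ⟪R x, y⟫ = ⟪x, R y⟫ := fun x y => hR.inner_left_eq_inner_right x y
  have key : ∀ x, ‖R x‖ ^ 2 ≤ c * ⟪R x, x⟫ := by
    intro x
    have h1 : 0 ≤ ⟪R (c • x - R x), c • x - R x⟫ := hR.inner_nonneg_left _
    have h2 : ⟪R (R x), R x⟫ ≤ c * ‖R x‖ ^ 2 := by
      calc ⟪R (R x), R x⟫ ≤ ‖R (R x)‖ * ‖R x‖ := real_inner_le_norm _ _
        _ ≤ (c * ‖R x‖) * ‖R x‖ := by gcongr; exact R.le_opNorm _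
        _ = c * ‖R x‖ ^ 2 := by ring
    have h3 : ⟪R (R x), x⟫ = ‖R x‖ ^ 2 := by
      rw [hsym, real_inner_self_eq_norm_sq]
    simp only [map_sub, map_smul, inner_sub_left, inner_sub_right, inner_smul_left,
      inner_smul_right, real_inner_self_eq_norm_sq, h3, RCLike.conj_to_real] at h1
    have h4 : 0 ≤ c * (c * ⟪R x, x⟫ - ‖R x‖ ^ 2) := by nlinarith
    nlinarith [nonneg_of_mul_nonneg_right h4 hc]
  obtain ⟨T, hT⟩ : ∃ T : H →L[ℝ] H, T = 1 - c⁻¹ • R := ⟨_, rfl⟩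
  have hTnorm : ‖T‖ ≤ 1 := by
    refine ContinuousLinearMap.opNorm_le_bound _ zero_le_one fun x => ?_
    rw [one_mul]
    refine le_of_sq_le_sq ?_ (norm_nonneg _)
    have hTx : T x = x - c⁻¹ • R x := by simp [hT]
    rw [hTx, @norm_sub_sq_real, norm_smul, inner_smul_right, real_inner_comm, mul_pow,
      Real.norm_eq_abs, sq_abs]
    have h5 : c⁻¹ ^ 2 * ‖R x‖ ^ 2 ≤ c⁻¹ ^ 2 * (c * ⟪R x, x⟫) := by gcongr; exact key x
    have h6 : c⁻¹ ^ 2 * (c * ⟪R x, x⟫) = c⁻¹ * ⟪R x, x⟫ := by field_simp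
    have h7 : 0 ≤ c⁻¹ * ⟪R x, x⟫ := mul_nonneg (inv_nonneg.mpr hc.le) (hR.inner_nonneg_left x)
    linarith
  have hTsa : IsSelfAdjoint T := by
    rw [hT]
    exact (IsSelfAdjoint.one _).sub ((IsSelfAdjoint.all c⁻¹).smul hR.isSelfAdjoint)
  obtain ⟨Z, hZeq, hZnorm, hZsa⟩ := exists_fixedPoint_of_norm_le_one T hTnorm hTsa
  have hS1 : (1 - Z : H →L[ℝ] H).IsPositive := by
    rw [ContinuousLinearMap.isPositive_iff']
    refine ⟨(IsSelfAdjoint.one _).sub hZsa, fun x => ?_⟩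
    have h1 : ⟪Z x, x⟫ ≤ ‖x‖ ^ 2 := by
      calc ⟪Z x, x⟫ ≤ ‖Z x‖ * ‖x‖ := real_inner_le_norm _ _
        _ ≤ (1 * ‖x‖) * ‖x‖ := by gcongr; exact Z.le_of_opNorm_le hZnorm x
        _ = ‖x‖ ^ 2 := by ring
    have h2 : ⟪(1 - Z : H →L[ℝ] H) x, x⟫ = ‖x‖ ^ 2 - ⟪Z x, x⟫ := by
      simp [inner_sub_left]
    rw [h2]; linarith
  have hsq : (1 - Z) * (1 - Z) = c⁻¹ • R := by
    have h2 : (2 : ℝ) • Z = T + Z * Z := by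
      conv_lhs => rw [hZeq]
      rw [smul_smul]; norm_num
    have h3 : Z + Z = T + Z * Z := by rw [← h2, two_smul]
    calc (1 - Z) * (1 - Z) = 1 - (Z + Z) + Z * Z := by noncomm_ring
      _ = 1 - T := by rw [h3]; abel
      _ = c⁻¹ • R := by simp [hT]
  refine ⟨Real.sqrt c • (1 - Z), hS1.smul_of_nonneg (Real.sqrt_nonneg c), ?_⟩
  rw [smul_mul_smul_comm, hsq, Real.mul_self_sqrt hc.le, smul_smul, mul_inv_cancel₀ hc.ne', one_smul]

/-- The (unique) positive square root `R^{1/2}` of a bounded positive operator `R`. -/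
noncomputable def posSqrt (R : H →L[ℝ] H) (hR : R.IsPositive) : H →L[ℝ] H :=
  Classical.choose (exists_isPositive_mul_self_eq R hR)

theorem posSqrt_isPositive (R : H →L[ℝ] H) (hR : R.IsPositive) : (posSqrt R hR).IsPositive :=
  (Classical.choose_spec (exists_isPositive_mul_self_eq R hR)).1

theorem posSqrt_mul_self (R : H →L[ℝ] H) (hR : R.IsPositive) :
    posSqrt R hR * posSqrt R hR = R :=
  (Classical.choose_spec (exists_isPositive_mul_self_eq R hR)).2

end SquareRoot

section Model

variable {H : Type*} [NormedAddCommGroup H] [InnerProductSpace ℝ H]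
variable {Ω : Type*} [MeasurableSpace Ω]

/-- `ξ` is a (generalized) Gaussian random vector in `H` with mean zero and covariance operator
`R`, given by its coordinates `ξ h`, which play the role of `⟪ξ, h⟫`: these are jointly Gaussian
centred random variables with `E[ξ g * ξ h] = ⟪R g, h⟫`. If `R` is of trace class, this is the
family of coordinates of a genuine `H`-valued Gaussian vector; `R = 1` is Gaussian white noise. -/
structure IsGaussianVector (R : H →L[ℝ] H) (ξ : H → Ω → ℝ) (P : Measure Ω) : Prop where
  measurable : ∀ h, Measurable (ξ h)
  gaussian : IsGaussianProcess ξ P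
  mean_zero : ∀ h, ∫ ω, ξ h ω ∂P = 0
  covariance : ∀ g h, ∫ ω, ξ g ω * ξ h ω ∂P = ⟪R g, h⟫

/-- The observation `Y = A x + ε ξ`, given by its coordinates `⟪Y, h⟫`, `h ∈ H`. -/
def observation (A : H →ₗ[ℝ] H) (ξ : H → Ω → ℝ) (ε : ℝ) (x : H) (ω : Ω) : H → ℝ :=
  fun h => ⟪A x, h⟫ + ε * ξ h ω

variable (H) in
/-- A (randomized) test: a measurable function of the observation with values in `[0, 1]`, the
probability of rejecting the hypothesis. The sample space `H → ℝ` carries the product `σ`-algebra,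
the one generated by the coordinates of the observation. -/
structure Test where
  toFun : (H → ℝ) → ℝ
  measurable : Measurable toFun
  mem_Icc : ∀ y, toFun y ∈ Set.Icc (0 : ℝ) 1

/-- The supremum over `x ∈ Θ₀` of the probabilities of type I error of the test `K`. -/
noncomputable def errorI (P : Measure Ω) (A : H →ₗ[ℝ] H) (ξ : H → Ω → ℝ) (Θ₀ : Set H) (ε : ℝ)
    (K : Test H) : ℝ :=
  ⨆ x : Θ₀, ∫ ω, K.toFun (observation A ξ ε x ω) ∂P

/-- The supremum over `x ∈ Θ₁` of the probabilities of type II error of the test `K`. -/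
noncomputable def errorII (P : Measure Ω) (A : H →ₗ[ℝ] H) (ξ : H → Ω → ℝ) (Θ₁ : Set H) (ε : ℝ)
    (K : Test H) : ℝ :=
  ⨆ x : Θ₁, ∫ ω, (1 - K.toFun (observation A ξ ε x ω)) ∂P

/-- The hypothesis `x ∈ Θ₀` and the alternative `x ∈ Θ₁` are distinguishable: for each level
`α ∈ (0, 1)` there are tests `K ε`, `ε > 0`, of type I error less than `α` whose type II
error tends to zero as `ε → 0`. -/
def Distinguishable (P : Measure Ω) (A : H →ₗ[ℝ] H) (ξ : H → Ω → ℝ) (Θ₀ Θ₁ : Set H) : Prop :=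
  ∀ α : ℝ, 0 < α → α < 1 → ∃ K : ℝ → Test H,
    (∀ ε : ℝ, 0 < ε → errorI P A ξ Θ₀ ε (K ε) < α) ∧
      Tendsto (fun ε => errorII P A ξ Θ₁ ε (K ε)) (𝓝[>] (0 : ℝ)) (𝓝 0)

/-- The hypothesis `x ∈ Θ₀` and the alternative `x ∈ Θ₁` are indistinguishable: for each `ε > 0`
no test has sum of its error probabilities less than one. -/
def Indistinguishable (P : Measure Ω) (A : H →ₗ[ℝ] H) (ξ : H → Ω → ℝ) (Θ₀ Θ₁ : Set H) : Prop :=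
  ∀ ε : ℝ, 0 < ε → ∀ K : Test H, 1 ≤ errorI P A ξ Θ₀ ε K + errorII P A ξ Θ₁ ε K

/-- The closure of a subset of `H` in the weak topology of `H`. -/
def weakClosure (s : Set H) : Set H :=
  toWeakSpace ℝ H ⁻¹' closure (toWeakSpace ℝ H '' s)

/-- The set `Λ_i = R^{-1/2} A Θ_i`, the preimage of `A Θ_i` under `R^{1/2}`. -/
def whitenedSet [CompleteSpace H] (R : H →L[ℝ] H) (hR : R.IsPositive) (A : H →ₗ[ℝ] H)
    (s : Set H) : Set H :=
  posSqrt R hR ⁻¹' (A '' s)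

/-- The closed linear span `Λ` of `Λ₀ ∪ Λ₁` contains a finite dimensional linear subspace `Γ` such
that the orthogonal projections to `Γ` of the (weak) closures of `Λ₀` and `Λ₁` are disjoint. -/
def HasSeparatingSubspace [CompleteSpace H] (Λ₀ Λ₁ : Set H) : Prop :=
  ∃ (Γ : Submodule ℝ H) (_ : FiniteDimensional ℝ Γ),
    Γ ≤ (Submodule.span ℝ (Λ₀ ∪ Λ₁)).topologicalClosure ∧
      Γ.starProjection '' weakClosure Λ₀ ∩ Γ.starProjection '' weakClosure Λ₁ = ∅

end Model

/-! Write `S` for `R^{1/2}`. If `A x = S v`, then `Y = ε (S (v / ε) + ξ)`, so everything depends on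
the shifts of `ξ` by `S u`, `u ∈ H`. By Cameron–Martin (`map_add_eq_map_withDensity`) such a shift
has a density `e u` in `L²(P)`. It satisfies `‖e u‖² = exp ‖u‖²`, and its inner product with the
exponential vector of `h` is `exp ⟪u, S h⟫`. Hence, for bounded `F`, the expectation of `F (S u +
ξ)` is the inner product of `F (ξ)` with `e u`, which is weakly continuous in `u` on bounded sets,
and error bounds on `Λ_i` pass to the weak closure (`integral_comp_add_le_of_mem_weakClosure`).

If no finite-dimensional projection separates the weak closures, weak compactness gives them a
common point (`exists_mem_weakClosure_inter`). There a single law obeys the bounds of both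
hypotheses, so the errors of any test add up to at least one.

If `Γ` separates them, the projections are disjoint compact sets, at a positive distance. Finitely
many coordinates of `Y` then tell `Λ₀` from `Λ₁` unless the noise in one of them exceeds a fixed
margin, which by Chebyshev has probability `O(ε²)`. -/

/-! ### The square root of the covariance operator -/

section PosSqrt

variable {H : Type*} [NormedAddCommGroup H] [InnerProductSpace ℝ H] [CompleteSpace H]

theorem posSqrt_inner (R : H →L[ℝ] H) (hR : R.IsPositive) (g h : H) :
    ⟪posSqrt R hR g, h⟫ = ⟪g, posSqrt R hR h⟫ :=
  (posSqrt_isPositive R hR).inner_left_eq_inner_right g h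

theorem inner_eq_inner_posSqrt (R : H →L[ℝ] H) (hR : R.IsPositive) (g h : H) :
    ⟪R g, h⟫ = ⟪posSqrt R hR g, posSqrt R hR h⟫ := by
  rw [← posSqrt_inner]
  conv_lhs => rw [← posSqrt_mul_self R hR]
  rfl

theorem posSqrt_injective (R : H →L[ℝ] H) (hR : R.IsPositive) (hRinj : Function.Injective R) :
    Function.Injective (posSqrt R hR) := by
  intro x y hxy
  apply hRinj
  rw [← posSqrt_mul_self R hR]
  exact congrArg (posSqrt R hR) hxy

/-- The orthogonal complement of the range of a self-adjoint operator is its kernel. -/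
theorem denseRange_posSqrt (R : H →L[ℝ] H) (hR : R.IsPositive) (hRinj : Function.Injective R) :
    DenseRange (posSqrt R hR) := by
  have h : ((posSqrt R hR).range : Submodule ℝ H)ᗮ = ⊥ := by
    rw [Submodule.eq_bot_iff]
    intro x hx
    apply posSqrt_injective R hR hRinj
    rw [map_zero, ← inner_self_eq_zero (𝕜 := ℝ), posSqrt_inner, real_inner_comm]
    exact hx _ ⟨posSqrt R hR x, rfl⟩
  have := (Submodule.topologicalClosure_eq_top_iff).mpr h
  rw [← Submodule.dense_iff_topologicalClosure_eq_top] at this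
  exact this

end PosSqrt

/-! ### Laws determined by moment generating functions -/

section LawDeterminedByMGF

variable {Ω Ω' : Type*} {mΩ : MeasurableSpace Ω} {mΩ' : MeasurableSpace Ω'}

/-- A moment generating function that is finite everywhere determines the law. -/
theorem map_eq_map_of_mgf_eq {μ : Measure Ω} {ν : Measure Ω'} [IsProbabilityMeasure μ]
    [IsProbabilityMeasure ν] {X : Ω → ℝ} {Y : Ω' → ℝ} (hX : AEMeasurable X μ)
    (hY : AEMeasurable Y ν) (hint : ∀ t, Integrable (fun ω => Real.exp (t * X ω)) μ)
    (h : mgf X μ = mgf Y ν) : μ.map X = ν.map Y := by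
  -- The two functions continue analytically to the strip over the interior of this set, here the
  -- whole complex plane.
  have huniv : integrableExpSet X μ = Set.univ := Set.eq_univ_of_forall hint
  refine Measure.ext_of_complexMGF_eq hX hY (funext fun z => eqOn_complexMGF_of_mgf h ?_)
  simp [huniv]

/-- Finite measures on a product of real lines, given as laws of two processes, agree if all finite
linear combinations of the coordinates have the same law. -/
theorem map_eq_map_of_sum {ι : Type*} {μ : Measure Ω} {ν : Measure Ω'} [IsFiniteMeasure μ]
    [IsFiniteMeasure ν] {X : ι → Ω → ℝ} {Y : ι → Ω' → ℝ} (hX : ∀ i, Measurable (X i))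
    (hY : ∀ i, Measurable (Y i))
    (h : ∀ (I : Finset ι) (c : I → ℝ), μ.map (fun ω => ∑ i : I, c i * X i ω)
      = ν.map (fun ω => ∑ i : I, c i * Y i ω)) :
    μ.map (fun ω i => X i ω) = ν.map (fun ω i => Y i ω) := by
  classical
  have hXm : Measurable fun ω i => X i ω := measurable_pi_lambda _ hX
  have hYm : Measurable fun ω i => Y i ω := measurable_pi_lambda _ hY
  -- Cramér–Wold: finite-dimensional marginals determine the measure, and the characteristic
  -- function of a marginal at `L` sees only the law of one linear combination of coordinates.
  refine IsProjectiveLimit.unique (P := fun I => (ν.map (fun ω i => Y i ω)).map I.restrict)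
    (fun I => ?_) (fun I => rfl)
  have hr : Measurable (I.restrict : (ι → ℝ) → (I → ℝ)) := Finset.measurable_restrict I
  refine Measure.ext_of_charFunDual (funext fun L => ?_)
  have key : ∀ y : ι → ℝ, L (I.restrict y) = ∑ i : I, L (Pi.single i 1) * y i := by
    intro y
    conv_lhs => rw [pi_eq_sum_univ' (I.restrict y)]
    simp [map_sum, mul_comm]
  beta_reduce
  rw [charFunDual_eq_charFun_map_one, charFunDual_eq_charFun_map_one,
    Measure.map_map hr hXm, Measure.map_map hr hYm, Measure.map_map (by fun_prop) (by fun_prop),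
    Measure.map_map (by fun_prop) (by fun_prop)]
  congr 1
  convert h I (fun i => L (Pi.single i 1)) using 2
  · exact funext fun ω => key _
  · exact funext fun ω => key _

end LawDeterminedByMGF

/-! ### Almost sure linearity and exponential moments of `ξ` -/

namespace IsGaussianVector

variable {H : Type*} [NormedAddCommGroup H] [InnerProductSpace ℝ H]
variable {Ω : Type*} [MeasurableSpace Ω] {P : Measure Ω} {R : H →L[ℝ] H} {ξ : H → Ω → ℝ}

theorem memLp_two (hξ : IsGaussianVector R ξ P) (h : H) : MemLp (ξ h) 2 P :=
  (hξ.gaussian.hasGaussianLaw_eval h).memLp_two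

/-- Linearity of `h ↦ ξ h` is not assumed; it follows from the covariance. The difference of the two
sides is orthogonal in `L²` to every `ξ a`, hence to itself, being a combination of such variables.
-/
theorem ae_sum_eq (hξ : IsGaussianVector R ξ P) {ι : Type*} (I : Finset ι) (c : ι → ℝ)
    (g : ι → H) : (fun ω => ∑ i ∈ I, c i * ξ (g i) ω) =ᵐ[P] ξ (∑ i ∈ I, c i • g i) := by
  set k : H := ∑ i ∈ I, c i • g i with hk
  have hint : ∀ a b, Integrable (fun ω => ξ a ω * ξ b ω) P := fun a b =>
    (hξ.memLp_two a).integrable_mul (hξ.memLp_two b)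
  have hD : MemLp (fun ω => (∑ i ∈ I, c i * ξ (g i) ω) - ξ k ω) 2 P :=
    (memLp_finsetSum I fun i _ => (hξ.memLp_two (g i)).const_mul (c i)).sub (hξ.memLp_two k)
  have hDk : ∀ a, ∫ ω, ((∑ i ∈ I, c i * ξ (g i) ω) - ξ k ω) * ξ a ω ∂P = 0 := by
    intro a
    have e : ∀ ω, ((∑ i ∈ I, c i * ξ (g i) ω) - ξ k ω) * ξ a ω
        = (∑ i ∈ I, c i * (ξ (g i) ω * ξ a ω)) - ξ k ω * ξ a ω := by
      intro ω
      rw [sub_mul, Finset.sum_mul]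
      simp only [mul_assoc]
    simp only [e]
    rw [integral_sub (integrable_finsetSum _ fun i _ => (hint _ _).const_mul _) (hint _ _),
      integral_finsetSum _ fun i _ => (hint _ _).const_mul _]
    simp only [integral_const_mul, hξ.covariance]
    simp [hk, sum_inner, inner_smul_left]
  have hsq : ∫ ω, ((∑ i ∈ I, c i * ξ (g i) ω) - ξ k ω) ^ 2 ∂P = 0 := by
    have e : ∀ ω, ((∑ i ∈ I, c i * ξ (g i) ω) - ξ k ω) ^ 2
        = (∑ i ∈ I, c i * (((∑ i ∈ I, c i * ξ (g i) ω) - ξ k ω) * ξ (g i) ω))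
          - ((∑ i ∈ I, c i * ξ (g i) ω) - ξ k ω) * ξ k ω := by
      intro ω
      simp only [mul_left_comm (c _)]
      rw [← Finset.mul_sum]
      ring
    have hi : ∀ a, Integrable (fun ω => ((∑ i ∈ I, c i * ξ (g i) ω) - ξ k ω) * ξ a ω) P :=
      fun a => hD.integrable_mul (hξ.memLp_two a)
    simp only [e]
    rw [integral_sub (integrable_finsetSum _ fun i _ => (hi _).const_mul _) (hi _),
      integral_finsetSum _ fun i _ => (hi _).const_mul _]
    simp only [integral_const_mul, hDk]
    simp
  rw [integral_eq_zero_iff_of_nonneg (fun ω => sq_nonneg _) hD.integrable_sq] at hsq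
  filter_upwards [hsq] with ω hω
  simpa [sub_eq_zero] using hω

theorem ae_add_eq (hξ : IsGaussianVector R ξ P) (g h : H) :
    ∀ᵐ ω ∂P, ξ g ω + ξ h ω = ξ (g + h) ω := by
  filter_upwards [hξ.ae_sum_eq Finset.univ (fun _ : Fin 2 => (1 : ℝ)) ![g, h]] with ω hω
  simpa using hω

theorem ae_smul_eq (hξ : IsGaussianVector R ξ P) (t : ℝ) (h : H) :
    ∀ᵐ ω ∂P, t * ξ h ω = ξ (t • h) ω := by
  filter_upwards [hξ.ae_sum_eq Finset.univ (fun _ : Fin 1 => t) ![h]] with ω hω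
  simpa using hω

variable [CompleteSpace H]

theorem map_eq_gaussianReal (hξ : IsGaussianVector R ξ P) (hR : R.IsPositive) (h : H) :
    P.map (ξ h) = gaussianReal 0 (‖posSqrt R hR h‖ ^ 2).toNNReal := by
  rw [(hξ.gaussian.hasGaussianLaw_eval h).map_eq_gaussianReal, hξ.mean_zero]
  congr 2
  rw [variance_of_integral_eq_zero (hξ.measurable h).aemeasurable (hξ.mean_zero h),
    ← real_inner_self_eq_norm_sq, ← inner_eq_inner_posSqrt, ← hξ.covariance]
  simp [pow_two]

theorem integrable_exp (hξ : IsGaussianVector R ξ P) (hR : R.IsPositive) (h : H) :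
    Integrable (fun ω => Real.exp (ξ h ω)) P := by
  have h1 := integrable_exp_mul_gaussianReal (μ := 0) (v := (‖posSqrt R hR h‖ ^ 2).toNNReal) 1
  rw [← hξ.map_eq_gaussianReal hR, integrable_map_measure (by fun_prop)
    (hξ.measurable h).aemeasurable] at h1
  simpa [Function.comp_def] using h1

theorem integral_exp (hξ : IsGaussianVector R ξ P) (hR : R.IsPositive) (h : H) :
    ∫ ω, Real.exp (ξ h ω) ∂P = Real.exp (‖posSqrt R hR h‖ ^ 2 / 2) := by
  have h1 := mgf_gaussianReal (hξ.map_eq_gaussianReal hR h) 1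
  simpa [mgf, Real.coe_toNNReal _ (sq_nonneg ‖posSqrt R hR h‖)] using h1

theorem memLp_exp (hξ : IsGaussianVector R ξ P) (hR : R.IsPositive) (h : H) (c : ℝ) :
    MemLp (fun ω => Real.exp (ξ h ω - c)) 2 P := by
  have hm := hξ.measurable h
  rw [memLp_two_iff_integrable_sq (by fun_prop)]
  have h1 := (hξ.integrable_exp hR (h + h)).mul_const (Real.exp (-(2 * c)))
  refine h1.congr ?_
  filter_upwards [hξ.ae_add_eq h h] with ω hω
  rw [← hω, ← Real.exp_add, ← Real.exp_nat_mul]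
  congr 1
  push_cast
  ring

end IsGaussianVector

/-! ### Exponential vectors and the Cameron–Martin theorem -/

namespace IsGaussianVector

variable {H : Type*} [NormedAddCommGroup H] [InnerProductSpace ℝ H] [CompleteSpace H]
variable {Ω : Type*} [MeasurableSpace Ω] {P : Measure Ω} {R : H →L[ℝ] H} {ξ : H → Ω → ℝ}

/-- The exponential vector `exp (ξ h - ‖R^{1/2} h‖² / 2)`, the density of the law of
`R h + ξ` with respect to the law of `ξ`. -/
noncomputable def expVec (hξ : IsGaussianVector R ξ P) (hR : R.IsPositive) (h : H) : Lp ℝ 2 P :=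
  (hξ.memLp_exp hR h (‖posSqrt R hR h‖ ^ 2 / 2)).toLp _

theorem coeFn_expVec (hξ : IsGaussianVector R ξ P) (hR : R.IsPositive) (h : H) :
    hξ.expVec hR h =ᵐ[P] fun ω => Real.exp (ξ h ω - ‖posSqrt R hR h‖ ^ 2 / 2) :=
  MemLp.coeFn_toLp _

/-- The normalising constants cancel the squares in `‖S (g + h)‖² / 2` and leave the cross term. The
result depends on `g` and `h` only through `S g` and `S h`, so the construction extends by
continuity from the dense range of `S` to `H`. -/
theorem inner_expVec (hξ : IsGaussianVector R ξ P) (hR : R.IsPositive) (g h : H) :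
    ⟪hξ.expVec hR g, hξ.expVec hR h⟫ = Real.exp ⟪posSqrt R hR g, posSqrt R hR h⟫ := by
  set S := posSqrt R hR with hS
  have e : (fun ω => ⟪hξ.expVec hR g ω, hξ.expVec hR h ω⟫) =ᵐ[P]
      fun ω => Real.exp (ξ (g + h) ω) * Real.exp (-(‖S g‖ ^ 2 / 2 + ‖S h‖ ^ 2 / 2)) := by
    filter_upwards [hξ.coeFn_expVec hR g, hξ.coeFn_expVec hR h, hξ.ae_add_eq g h]
      with ω h1 h2 h3
    rw [h1, h2, ← h3, real_inner_eq_re_inner, RCLike.inner_apply]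
    simp only [conj_trivial, RCLike.re_to_real]
    rw [← Real.exp_add, ← Real.exp_add]
    congr 1
    ring
  rw [L2.inner_def, integral_congr_ae e, integral_mul_const, hξ.integral_exp hR, ← Real.exp_add,
    map_add, norm_add_sq_real]
  congr 1
  ring

/-- Each `u ∈ H` has an exponential vector: formally `exp (ξ (R^{-1/2} u) - ‖u‖² / 2)`. -/
theorem exists_expVec_limit (hξ : IsGaussianVector R ξ P) (hR : R.IsPositive)
    (hRinj : Function.Injective R) (u : H) :
    ∃ e : Lp ℝ 2 P, e ∈ closure (Set.range (hξ.expVec hR)) ∧ 0 ≤ e ∧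
      (∀ h, ⟪e, hξ.expVec hR h⟫ = Real.exp ⟪u, posSqrt R hR h⟫) ∧
      ‖e‖ ^ 2 = Real.exp (‖u‖ ^ 2) := by
  set S := posSqrt R hR with hS
  set E := hξ.expVec hR with hE
  obtain ⟨v, hv, hvu⟩ := mem_closure_iff_seq_limit.mp ((denseRange_posSqrt R hR hRinj) u)
  choose g hg using hv
  have hgu : Tendsto (fun n => S (g n)) atTop (𝓝 u) := hvu.congr fun n => (hg n).symm
  have hEE : ∀ a b, ⟪E a, E b⟫ = Real.exp ⟪S a, S b⟫ := hξ.inner_expVec hR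
  have hcauchy : CauchySeq fun n => E (g n) := by
    rw [cauchySeq_iff_tendsto_dist_atTop_0]
    -- All three inner products tend to `‖u‖²`, so the expression under the root tends to `(1 - 2 +
    -- 1) exp ‖u‖² = 0`.
    have hd : ∀ n : ℕ × ℕ, dist (E (g n.1)) (E (g n.2))
        = √(Real.exp ⟪S (g n.1), S (g n.1)⟫ - 2 * Real.exp ⟪S (g n.1), S (g n.2)⟫
          + Real.exp ⟪S (g n.2), S (g n.2)⟫) := by
      intro n
      rw [dist_eq_norm, ← Real.sqrt_sq (norm_nonneg (E (g n.1) - E (g n.2))), norm_sub_sq_real,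
        ← real_inner_self_eq_norm_sq, ← real_inner_self_eq_norm_sq, hEE, hEE, hEE]
    simp only [hd]
    have h1 : Tendsto (fun n : ℕ × ℕ => S (g n.1)) atTop (𝓝 u) :=
      hgu.comp (by rw [← prod_atTop_atTop_eq]; exact tendsto_fst)
    have h2 : Tendsto (fun n : ℕ × ℕ => S (g n.2)) atTop (𝓝 u) :=
      hgu.comp (by rw [← prod_atTop_atTop_eq]; exact tendsto_snd)
    have h3 := (((h1.inner (𝕜 := ℝ) h1).rexp.sub (((h1.inner (𝕜 := ℝ) h2).rexp).const_mul 2)).add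
      (h2.inner (𝕜 := ℝ) h2).rexp).sqrt
    convert h3 using 2
    rw [eq_comm, Real.sqrt_eq_zero_of_nonpos]
    linarith
  obtain ⟨e, he⟩ := cauchySeq_tendsto_of_complete hcauchy
  refine ⟨e, mem_closure_of_tendsto he (Eventually.of_forall fun n => ⟨g n, rfl⟩), ?_, ?_, ?_⟩
  · refine ge_of_tendsto' he fun n => ?_
    rw [← Lp.coeFn_nonneg]
    filter_upwards [hξ.coeFn_expVec hR (g n)] with ω hω
    rw [hω]
    exact (Real.exp_pos _).le
  · intro h
    refine tendsto_nhds_unique (he.inner (𝕜 := ℝ) tendsto_const_nhds) ?_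
    simp only [hEE]
    exact (hgu.inner tendsto_const_nhds).rexp
  · rw [← real_inner_self_eq_norm_sq, ← real_inner_self_eq_norm_sq]
    refine tendsto_nhds_unique (he.inner (𝕜 := ℝ) he) ?_
    simp only [hEE]
    exact (hgu.inner hgu).rexp

/-- The **Cameron–Martin theorem** in terms of exponential vectors: if `e ≥ 0` has the same
inner products with the exponential vectors as the exponential vector of `u`, it is the density of
the law of `R^{1/2} u + ξ` with respect to the law of `ξ`. -/
theorem map_add_eq_map_withDensity [IsProbabilityMeasure P] (hξ : IsGaussianVector R ξ P)
    (hR : R.IsPositive) (u : H) (e : Lp ℝ 2 P) (he0 : 0 ≤ e)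
    (he : ∀ h, ⟪e, hξ.expVec hR h⟫ = Real.exp ⟪u, posSqrt R hR h⟫) :
    P.map (fun ω h => ⟪posSqrt R hR u, h⟫ + ξ h ω)
      = (P.withDensity fun ω => ENNReal.ofReal (e ω)).map (fun ω h => ξ h ω) := by
  set S := posSqrt R hR with hS
  have he0' : 0 ≤ᵐ[P] e := Lp.coeFn_nonneg e |>.mpr he0
  have heint : Integrable e P := (Lp.memLp e).integrable (by norm_num)
  have hem : AEMeasurable (fun ω => ENNReal.ofReal (e ω)) P :=
    heint.aestronglyMeasurable.aemeasurable.ennreal_ofReal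
  set Q := P.withDensity fun ω => ENNReal.ofReal (e ω) with hQ
  have hQint : ∀ f : Ω → ℝ, ∫ ω, f ω ∂Q = ∫ ω, e ω * f ω ∂P := by
    intro f
    rw [hQ, integral_withDensity_eq_integral_toReal_smul₀ hem (by simp)]
    refine integral_congr_ae ?_
    filter_upwards [he0'] with ω hω
    rw [ENNReal.toReal_ofReal hω, smul_eq_mul]
  have hexp : ∀ h, ∫ ω, e ω * Real.exp (ξ h ω) ∂P = Real.exp (⟪u, S h⟫ + ‖S h‖ ^ 2 / 2) := by
    intro h
    rw [Real.exp_add, ← he h, L2.inner_def, ← integral_mul_const]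
    refine integral_congr_ae ?_
    filter_upwards [hξ.coeFn_expVec hR h] with ω hω
    rw [hω, real_inner_eq_re_inner, RCLike.inner_apply]
    simp only [conj_trivial, RCLike.re_to_real]
    rw [Real.exp_sub, mul_right_comm, div_mul_cancel₀ _ (Real.exp_pos _).ne', mul_comm]
  have hξ0 : ∀ᵐ ω ∂P, ξ 0 ω = 0 := by
    filter_upwards [hξ.ae_smul_eq 0 0] with ω hω
    simpa using hω.symm
  -- The exponential vector of `0` is almost surely `1`, so testing against it gives the total mass.
  have he1 : ∫ ω, e ω ∂P = 1 := by
    have h1 := hexp 0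
    simp only [map_zero, inner_zero_right, norm_zero] at h1
    rw [← integral_congr_ae (f := fun ω => e ω * Real.exp (ξ 0 ω)), h1]
    · simp
    · filter_upwards [hξ0] with ω hω
      simp [hω]
  have hQprob : IsProbabilityMeasure Q := by
    constructor
    rw [hQ, withDensity_apply _ MeasurableSet.univ, setLIntegral_univ,
      ← ofReal_integral_eq_lintegral_ofReal heint he0', he1, ENNReal.ofReal_one]
  have hQac : Q ≪ P := withDensity_absolutelyContinuous _ _
  refine map_eq_map_of_sum (fun h => (hξ.measurable h).const_add _) hξ.measurable
    fun I c => ?_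
  set k : H := ∑ i : I, c i • (i : H) with hk
  have hsum : (fun ω => ∑ i : I, c i * ξ (i : H) ω) =ᵐ[P] ξ k :=
    hξ.ae_sum_eq Finset.univ c (fun i => (i : H))
  have e1 : P.map (fun ω => ∑ i : I, c i * (⟪S u, (i : H)⟫ + ξ (i : H) ω))
      = P.map (fun ω => ⟪S u, k⟫ + ξ k ω) := by
    refine Measure.map_congr ?_
    filter_upwards [hsum] with ω hω
    rw [← hω, hk]
    simp [inner_sum, inner_smul_right, mul_add, Finset.sum_add_distrib]
  have e2 : Q.map (fun ω => ∑ i : I, c i * ξ (i : H) ω) = Q.map (ξ k) :=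
    Measure.map_congr (hQac.ae_eq hsum)
  rw [e1, e2]
  have hmk := hξ.measurable k
  have hpt : ∀ t : ℝ, (fun ω => Real.exp (t * (⟪S u, k⟫ + ξ k ω))) =ᵐ[P]
      fun ω => Real.exp (t * ⟪S u, k⟫) * Real.exp (ξ (t • k) ω) := by
    intro t
    filter_upwards [hξ.ae_smul_eq t k] with ω hω
    rw [← hω, ← Real.exp_add, mul_add]
  -- Both moment generating functions at `t` equal `exp (t ⟪S u, k⟫ + ‖S (t • k)‖² / 2)`.
  refine map_eq_map_of_mgf_eq (by fun_prop) hmk.aemeasurable (fun t => ?_) (funext fun t => ?_)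
  · exact ((hξ.integrable_exp hR (t • k)).const_mul _).congr (hpt t).symm
  · rw [mgf, mgf, hQint, integral_congr_ae (hpt t), integral_const_mul, hξ.integral_exp hR,
      ← Real.exp_add]
    have e3 : (fun ω => e ω * Real.exp (t * ξ k ω)) =ᵐ[P]
        fun ω => e ω * Real.exp (ξ (t • k) ω) := by
      filter_upwards [hξ.ae_smul_eq t k] with ω hω
      rw [hω]
    rw [integral_congr_ae e3, hexp, map_smul, inner_smul_right, posSqrt_inner]

/-- Change of variables with the Cameron–Martin density. It makes the expectation under a shift a
bounded linear functional of that density, to which weak convergence in `L²` applies. -/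
theorem integral_comp_add_eq_inner [IsProbabilityMeasure P] (hξ : IsGaussianVector R ξ P)
    (hR : R.IsPositive) (u : H) (e : Lp ℝ 2 P) (he0 : 0 ≤ e)
    (he : ∀ h, ⟪e, hξ.expVec hR h⟫ = Real.exp ⟪u, posSqrt R hR h⟫) {F : (H → ℝ) → ℝ}
    (hF : Measurable F) (hFL : MemLp (fun ω => F fun h => ξ h ω) 2 P) :
    ∫ ω, F (fun h => ⟪posSqrt R hR u, h⟫ + ξ h ω) ∂P = ⟪hFL.toLp _, e⟫ := by
  have he0' : 0 ≤ᵐ[P] e := Lp.coeFn_nonneg e |>.mpr he0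
  have hem : AEMeasurable (fun ω => ENNReal.ofReal (e ω)) P :=
    (Lp.aestronglyMeasurable e).aemeasurable.ennreal_ofReal
  have hm1 : Measurable fun ω h => ⟪posSqrt R hR u, h⟫ + ξ h ω :=
    measurable_pi_lambda _ fun h => (hξ.measurable h).const_add _
  have hm2 : Measurable fun ω h => ξ h ω := measurable_pi_lambda _ hξ.measurable
  rw [← integral_map (φ := fun ω h => ⟪posSqrt R hR u, h⟫ + ξ h ω) (f := F) hm1.aemeasurable
      hF.aestronglyMeasurable, hξ.map_add_eq_map_withDensity hR u e he0 he,
    integral_map hm2.aemeasurable hF.aestronglyMeasurable,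
    integral_withDensity_eq_integral_toReal_smul₀ hem (by simp), L2.inner_def]
  refine integral_congr_ae ?_
  filter_upwards [he0', hFL.coeFn_toLp] with ω h1 h2
  rw [h2, ENNReal.toReal_ofReal h1, smul_eq_mul, real_inner_eq_re_inner, RCLike.inner_apply]
  simp

end IsGaussianVector

/-! ### Weak closures, weak compactness and weak convergence -/

section WeakTopology

variable {H : Type*} [NormedAddCommGroup H] [InnerProductSpace ℝ H]

theorem continuous_inner_weakSpace (w : H) :
    Continuous fun v : WeakSpace ℝ H => ⟪(toWeakSpace ℝ H).symm v, w⟫ := by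
  have h := WeakBilin.eval_continuous (topDualPairing ℝ H).flip (innerSL ℝ w)
  refine h.congr fun v => ?_
  exact real_inner_comm _ _

theorem exists_filter_of_mem_weakClosure {s : Set H} {u : H} (hu : u ∈ weakClosure s) :
    ∃ l : Filter H, l.NeBot ∧ s ∈ l ∧ ∀ w, Tendsto (fun v => ⟪v, w⟫) l (𝓝 ⟪u, w⟫) := by
  have h1 : (𝓝[toWeakSpace ℝ H '' s] (toWeakSpace ℝ H u)).NeBot :=
    mem_closure_iff_nhdsWithin_neBot.mp hu
  refine ⟨(𝓝[toWeakSpace ℝ H '' s] (toWeakSpace ℝ H u)).map (toWeakSpace ℝ H).symm,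
    h1.map _, ?_, fun w => ?_⟩
  · rw [mem_map]
    filter_upwards [self_mem_nhdsWithin] with v hv
    obtain ⟨x, hx, rfl⟩ := hv
    simpa using hx
  · rw [tendsto_map'_iff]
    have h2 := ((continuous_inner_weakSpace w).tendsto (toWeakSpace ℝ H u)).mono_left
      (nhdsWithin_le_nhds (s := toWeakSpace ℝ H '' s))
    simpa [Function.comp_def] using h2

/-- Banach–Alaoglu in the bidual, combined with the reflexivity of `H`. -/
theorem isCompact_closure_toWeakSpace_image [CompleteSpace H] {s : Set H}
    (hs : Bornology.IsBounded s) : IsCompact (closure (toWeakSpace ℝ H '' s)) := by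
  refine NormedSpace.isCompact_closure_of_isBounded ℝ H _ ?_ ?_
  · rwa [Set.preimage_image_eq _ (toWeakSpace ℝ H).injective]
  · refine (Set.subset_univ _).trans fun φ _ => ?_
    -- Reflexivity through Riesz: `ψ` composed with the Riesz map is a functional `f` on `H`, and
    -- the vector representing `f` is the preimage of `φ`.
    let ψ : StrongDual ℝ (StrongDual ℝ H) := WeakDual.toStrongDual φ
    let f : StrongDual ℝ H := LinearMap.mkContinuous
      { toFun := fun w => ψ (innerSL ℝ w)
        map_add' := fun w w' => by rw [map_add, map_add]
        map_smul' := fun c w => by rw [map_smulₛₗ, map_smul]; rfl } ‖ψ‖ fun w =>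
          (ψ.le_opNorm _).trans_eq (by rw [innerSL_apply_norm])
    refine ⟨toWeakSpace ℝ H ((InnerProductSpace.toDual ℝ H).symm f), ?_⟩
    refine DFunLike.ext _ _ fun g => ?_
    obtain ⟨w, rfl⟩ := (InnerProductSpace.toDual ℝ H).surjective g
    change InnerProductSpace.toDual ℝ H w ((InnerProductSpace.toDual ℝ H).symm f) = f w
    rw [InnerProductSpace.toDual_apply_apply, real_inner_comm,
      InnerProductSpace.toDual_symm_apply]

theorem starProjection_eq_iff (Γ : Submodule ℝ H) [Γ.HasOrthogonalProjection] (u v : H) :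
    Γ.starProjection u = Γ.starProjection v ↔ ∀ w ∈ Γ, ⟪u, w⟫ = ⟪v, w⟫ := by
  rw [← sub_eq_zero, ← map_sub, Submodule.starProjection_apply_eq_zero_iff,
    Submodule.mem_orthogonal']
  simp only [inner_sub_left, sub_eq_zero]

/-- Mazur: the norm closure of a convex set is weakly closed. Thus points of the weak closures, and
their differences, lie in `Λ`. -/
theorem weakClosure_subset_topologicalClosure_span (s : Set H) :
    weakClosure s ⊆ (Submodule.span ℝ s).topologicalClosure := by
  intro u hu
  have hc : (toWeakSpace ℝ H u) ∈ toWeakSpace ℝ H '' closure (Submodule.span ℝ s : Set H) := by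
    rw [(Submodule.span ℝ s).convex.toWeakSpace_closure (𝕜 := ℝ)]
    exact closure_mono (Set.image_mono Submodule.subset_span) hu
  obtain ⟨x, hx, hxu⟩ := hc
  rw [← (toWeakSpace ℝ H).injective hxu]
  exact hx

/-- If no finite-dimensional projection separates the weak closures of two bounded sets, these
weak closures have a common point. -/
theorem exists_mem_weakClosure_inter [CompleteSpace H] {s t : Set H} (hs : Bornology.IsBounded s)
    (ht : Bornology.IsBounded t) (h : ¬ HasSeparatingSubspace s t) :
    (weakClosure s ∩ weakClosure t).Nonempty := by
  set W := Submodule.span ℝ (s ∪ t) with hW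
  have hsW : weakClosure s ⊆ W.topologicalClosure :=
    (weakClosure_subset_topologicalClosure_span s).trans
      (Submodule.topologicalClosure_mono (Submodule.span_mono Set.subset_union_left))
  have htW : weakClosure t ⊆ W.topologicalClosure :=
    (weakClosure_subset_topologicalClosure_span t).trans
      (Submodule.topologicalClosure_mono (Submodule.span_mono Set.subset_union_right))
  -- Finite intersection property on pairs of points: `Z w` consists of the pairs that agree in the
  -- direction `w`.
  let K := closure (toWeakSpace ℝ H '' s) ×ˢ closure (toWeakSpace ℝ H '' t)
  have hK : IsCompact K :=
    (isCompact_closure_toWeakSpace_image hs).prod (isCompact_closure_toWeakSpace_image ht)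
  let Z : W.topologicalClosure → Set (WeakSpace ℝ H × WeakSpace ℝ H) := fun w =>
    {p | ⟪(toWeakSpace ℝ H).symm p.1, (w : H)⟫ = ⟪(toWeakSpace ℝ H).symm p.2, (w : H)⟫}
  have hZ : ∀ w, IsClosed (Z w) := fun w =>
    isClosed_eq ((continuous_inner_weakSpace (w : H)).comp continuous_fst)
      ((continuous_inner_weakSpace (w : H)).comp continuous_snd)
  have hfin : ∀ I : Finset W.topologicalClosure, (K ∩ ⋂ w ∈ I, Z w).Nonempty := by
    intro I
    by_contra hI
    apply h
    -- If no pair in `K` agrees on the finitely many directions in `I`, their span is a separating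
    -- subspace.
    let Γ : Submodule ℝ H := Submodule.span ℝ (Subtype.val '' (I : Set W.topologicalClosure))
    have hΓfin : FiniteDimensional ℝ Γ :=
      FiniteDimensional.span_of_finite ℝ (I.finite_toSet.image _)
    refine ⟨Γ, hΓfin, ?_, ?_⟩
    · rw [Submodule.span_le]
      rintro _ ⟨w, -, rfl⟩
      exact w.2
    · rw [Set.eq_empty_iff_forall_notMem]
      rintro _ ⟨⟨u, hu, rfl⟩, ⟨v, hv, hvu⟩⟩
      apply hI
      refine ⟨(toWeakSpace ℝ H u, toWeakSpace ℝ H v), ⟨hu, hv⟩, ?_⟩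
      rw [eq_comm, starProjection_eq_iff] at hvu
      simp only [Set.mem_iInter]
      intro w hw
      simpa [Z] using hvu w (Submodule.subset_span ⟨w, hw, rfl⟩)
  obtain ⟨p, ⟨hp1, hp2⟩, hpZ⟩ := hK.inter_iInter_nonempty Z hZ hfin
  obtain ⟨u, hu⟩ := (toWeakSpace ℝ H).surjective p.1
  obtain ⟨v, hv⟩ := (toWeakSpace ℝ H).surjective p.2
  rw [← hu] at hp1
  rw [← hv] at hp2
  -- The difference `u - v` is itself a direction in `Λ`, so it is orthogonal to itself.
  have huv : u = v := by
    rw [← sub_eq_zero, ← inner_self_eq_zero (𝕜 := ℝ)]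
    have h1 := Set.mem_iInter.mp hpZ ⟨u - v, sub_mem (hsW hp1) (htW hp2)⟩
    simp only [Z, Set.mem_ofPred_eq, ← hu, ← hv, LinearEquiv.symm_apply_apply] at h1
    rw [inner_sub_left, h1, sub_self]
  exact ⟨u, hp1, huv ▸ hp2⟩

/-- A family in the closed span of `G` converges weakly if it is bounded and its inner products
with the elements of `G` converge. -/
theorem tendsto_inner_of_closure_span {E α : Type*} [NormedAddCommGroup E] [InnerProductSpace ℝ E]
    [CompleteSpace E] {l : Filter α} {e : α → E} {e₀ : E} {C : ℝ} (G : Set E)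
    (hbdd : ∀ᶠ a in l, ‖e a‖ ≤ C) (he : ∀ a, e a ∈ closure (Submodule.span ℝ G : Set E))
    (he₀ : e₀ ∈ closure (Submodule.span ℝ G : Set E))
    (hG : ∀ g ∈ G, Tendsto (fun a => ⟪g, e a⟫) l (𝓝 ⟪g, e₀⟫)) (k : E) :
    Tendsto (fun a => ⟪k, e a⟫) l (𝓝 ⟪k, e₀⟫) := by
  set W := (Submodule.span ℝ G).topologicalClosure with hW
  have hWc : IsClosed (W : Set E) := Submodule.isClosed_topologicalClosure _
  have : CompleteSpace W := hWc.completeSpace_coe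
  have hspan : ∀ g ∈ Submodule.span ℝ G, Tendsto (fun a => ⟪g, e a⟫) l (𝓝 ⟪g, e₀⟫) := by
    intro g hg
    induction hg using Submodule.span_induction with
    | mem g hg => exact hG g hg
    | zero => simpa using tendsto_const_nhds
    | add x y _ _ hx hy => simpa only [inner_add_left] using hx.add hy
    | smul c x _ hx => simpa only [inner_smul_left] using hx.const_mul _
  -- All the vectors lie in `W`, so `k` may be replaced by its projection to `W`, which is a norm
  -- limit of combinations of `G`; an `ε / 3` argument then uses the uniform bound.
  have hproj : ∀ x ∈ W, ⟪k, x⟫ = ⟪W.starProjection k, x⟫ := by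
    intro x hx
    rw [Submodule.inner_starProjection_left_eq_right, Submodule.starProjection_eq_self_iff.mpr hx]
  simp only [fun a => hproj (e a) (he a), hproj e₀ he₀]
  set p := W.starProjection k
  have hp : p ∈ closure (Submodule.span ℝ G : Set E) := W.starProjection_apply_mem k
  set C' := max C ‖e₀‖ + 1 with hC'
  have hC'pos : 0 < C' := by
    have := (norm_nonneg e₀).trans (le_max_right C ‖e₀‖)
    linarith
  rw [Metric.tendsto_nhds]
  intro ε hε
  obtain ⟨g, hg, hpg⟩ := Metric.mem_closure_iff.mp hp (ε / (3 * C')) (by positivity)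
  rw [dist_eq_norm] at hpg
  filter_upwards [Metric.tendsto_nhds.mp (hspan g hg) (ε / 3) (by positivity), hbdd] with a ha hb
  have hle : ∀ x : E, ‖x‖ ≤ C' → |⟪p - g, x⟫| ≤ ε / 3 := by
    intro x hx
    calc |⟪p - g, x⟫| ≤ ‖p - g‖ * ‖x‖ := abs_real_inner_le_norm _ _
      _ ≤ ε / (3 * C') * C' := by gcongr
      _ = ε / 3 := by field_simp
  have h1 := hle (e a) (by linarith [le_max_left C ‖e₀‖])
  have h2 := hle e₀ (by linarith [le_max_right C ‖e₀‖])
  rw [Real.dist_eq] at ha ⊢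
  rw [inner_sub_left, abs_le] at h1 h2
  rw [abs_lt] at ha ⊢
  constructor <;> linarith [h1.1, h1.2, h2.1, h2.2, ha.1, ha.2]

end WeakTopology

/-! ### Weak continuity of expectations under shifts -/

namespace IsGaussianVector

variable {H : Type*} [NormedAddCommGroup H] [InnerProductSpace ℝ H] [CompleteSpace H]
variable {Ω : Type*} [MeasurableSpace Ω] {P : Measure Ω} {R : H →L[ℝ] H} {ξ : H → Ω → ℝ}

/-- The expectation `u ↦ E F (R^{1/2} u + ξ)` is weakly continuous on bounded sets: an upper bound
on a bounded set extends to its weak closure. -/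
theorem integral_comp_add_le_of_mem_weakClosure [IsProbabilityMeasure P]
    (hξ : IsGaussianVector R ξ P) (hR : R.IsPositive) (hRinj : Function.Injective R)
    {F : (H → ℝ) → ℝ} (hF : Measurable F) (hFL : MemLp (fun ω => F fun h => ξ h ω) 2 P)
    {s : Set H} (hs : Bornology.IsBounded s) {u : H} (hu : u ∈ weakClosure s) (r : ℝ) {c : ℝ}
    (hc : ∀ v ∈ s, ∫ ω, F (fun h => ⟪posSqrt R hR (r • v), h⟫ + ξ h ω) ∂P ≤ c) :
    ∫ ω, F (fun h => ⟪posSqrt R hR (r • u), h⟫ + ξ h ω) ∂P ≤ c := by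
  choose e hecl he0 he henorm using hξ.exists_expVec_limit hR hRinj
  have key := fun v => hξ.integral_comp_add_eq_inner hR v (e v) (he0 v) (he v) hF hFL
  obtain ⟨l, hl, hsl, hlim⟩ := exists_filter_of_mem_weakClosure hu
  obtain ⟨M, hM⟩ := hs.exists_norm_le
  have hcl : ∀ v, e v ∈ closure (Submodule.span ℝ (Set.range (hξ.expVec hR)) : Set _) :=
    fun v => closure_mono Submodule.subset_span (hecl v)
  -- The densities converge weakly in `L²`: they are bounded, since `‖e (r • v)‖² = exp (r² ‖v‖²)`,
  -- and their inner products with exponential vectors are continuous in `⟪v, S h⟫`.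
  have ht : Tendsto (fun v => ⟪hFL.toLp _, e (r • v)⟫) l (𝓝 ⟪hFL.toLp _, e (r • u)⟫) := by
    refine tendsto_inner_of_closure_span (C := √(Real.exp ((|r| * M) ^ 2)))
      (Set.range (hξ.expVec hR)) ?_ (fun v => hcl _) (hcl _) ?_ _
    · filter_upwards [hsl] with v hv
      rw [← Real.sqrt_sq (norm_nonneg (e (r • v))), henorm, norm_smul, Real.norm_eq_abs]
      gcongr
      exact hM v hv
    · rintro _ ⟨h, rfl⟩
      have hinner : ∀ v, ⟪hξ.expVec hR h, e (r • v)⟫ = Real.exp (r * ⟪v, posSqrt R hR h⟫) := by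
        intro v
        rw [real_inner_comm, he, real_inner_smul_left]
      simp only [hinner]
      exact ((hlim _).const_mul _).rexp
  rw [key]
  refine le_of_tendsto ht ?_
  filter_upwards [hsl] with v hv
  rw [← key]
  exact hc v hv

end IsGaussianVector

/-! ### Elementary bounds on the errors of a test -/

section Errors

variable {H : Type*} [NormedAddCommGroup H] [InnerProductSpace ℝ H]
variable {Ω : Type*} [MeasurableSpace Ω] {P : Measure Ω}

theorem measurable_observation (A : H →ₗ[ℝ] H) {ξ : H → Ω → ℝ} (hξ : ∀ h, Measurable (ξ h))
    (ε : ℝ) (x : H) : Measurable (observation A ξ ε x) :=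
  measurable_pi_lambda _ fun h => ((hξ h).const_mul ε).const_add _

theorem Test.integrable_comp [IsFiniteMeasure P] (K : Test H) {Y : Ω → H → ℝ}
    (hY : Measurable Y) : Integrable (fun ω => K.toFun (Y ω)) P := by
  refine Integrable.of_bound (K.measurable.comp hY).aestronglyMeasurable 1
    (Eventually.of_forall fun ω => ?_)
  rw [Real.norm_of_nonneg (K.mem_Icc _).1]
  exact (K.mem_Icc _).2

theorem Test.integral_one_sub [IsProbabilityMeasure P] (K : Test H) {Y : Ω → H → ℝ}
    (hY : Measurable Y) : ∫ ω, (1 - K.toFun (Y ω)) ∂P = 1 - ∫ ω, K.toFun (Y ω) ∂P := by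
  rw [integral_sub (integrable_const 1) (K.integrable_comp hY)]
  simp

theorem Test.integral_mem_Icc [IsProbabilityMeasure P] (K : Test H) {Y : Ω → H → ℝ}
    (hY : Measurable Y) : ∫ ω, K.toFun (Y ω) ∂P ∈ Set.Icc (0 : ℝ) 1 := by
  refine ⟨integral_nonneg fun ω => (K.mem_Icc _).1, ?_⟩
  have h : 0 ≤ ∫ ω, (1 - K.toFun (Y ω)) ∂P := integral_nonneg fun ω => by
    have := (K.mem_Icc (Y ω)).2
    simpa using this
  rw [K.integral_one_sub hY] at h
  linarith

theorem integral_le_errorI [IsProbabilityMeasure P] {A : H →ₗ[ℝ] H} {ξ : H → Ω → ℝ}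
    (hξ : ∀ h, Measurable (ξ h)) {Θ₀ : Set H} (ε : ℝ) (K : Test H) {x : H} (hx : x ∈ Θ₀) :
    ∫ ω, K.toFun (observation A ξ ε x ω) ∂P ≤ errorI P A ξ Θ₀ ε K := by
  refine le_ciSup (f := fun x : Θ₀ => ∫ ω, K.toFun (observation A ξ ε x ω) ∂P) ⟨1, ?_⟩ ⟨x, hx⟩
  rintro _ ⟨y, rfl⟩
  exact (K.integral_mem_Icc (measurable_observation A hξ ε y)).2

theorem integral_le_errorII [IsProbabilityMeasure P] {A : H →ₗ[ℝ] H} {ξ : H → Ω → ℝ}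
    (hξ : ∀ h, Measurable (ξ h)) {Θ₁ : Set H} (ε : ℝ) (K : Test H) {x : H} (hx : x ∈ Θ₁) :
    1 - ∫ ω, K.toFun (observation A ξ ε x ω) ∂P ≤ errorII P A ξ Θ₁ ε K := by
  rw [← K.integral_one_sub (measurable_observation A hξ ε x)]
  refine le_ciSup (f := fun x : Θ₁ => ∫ ω, (1 - K.toFun (observation A ξ ε x ω)) ∂P)
    ⟨1, ?_⟩ ⟨x, hx⟩
  rintro _ ⟨y, rfl⟩
  have hY := measurable_observation A hξ ε y
  beta_reduce
  rw [K.integral_one_sub hY]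
  linarith [(K.integral_mem_Icc (P := P) hY).1]

end Errors

/-! ### A common weak limit point prevents testing -/

section Indistinguishable

variable {H : Type*} [NormedAddCommGroup H] [InnerProductSpace ℝ H] [CompleteSpace H]
variable {Ω : Type*} [MeasurableSpace Ω] {P : Measure Ω} {R : H →L[ℝ] H} {ξ : H → Ω → ℝ}

theorem indistinguishable_of_mem_weakClosure_inter [IsProbabilityMeasure P]
    (hξ : IsGaussianVector R ξ P) (hR : R.IsPositive) (hRinj : Function.Injective R)
    (A : H →ₗ[ℝ] H) {Θ₀ Θ₁ : Set H}
    (hbdd₀ : Bornology.IsBounded (whitenedSet R hR A Θ₀))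
    (hbdd₁ : Bornology.IsBounded (whitenedSet R hR A Θ₁)) {u : H}
    (hu₀ : u ∈ weakClosure (whitenedSet R hR A Θ₀))
    (hu₁ : u ∈ weakClosure (whitenedSet R hR A Θ₁)) : Indistinguishable P A ξ Θ₀ Θ₁ := by
  intro ε hε K
  have hscale : Measurable fun y : H → ℝ => ε • y := measurable_const_smul ε
  have hξm : Measurable fun ω h => ξ h ω := measurable_pi_lambda _ hξ.measurable
  have hobs : ∀ x v, A x = posSqrt R hR v → ∀ ω,
      observation A ξ ε x ω = ε • fun h => ⟪posSqrt R hR (ε⁻¹ • v), h⟫ + ξ h ω := by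
    intro x v hxv ω
    funext h
    simp only [observation, hxv, Pi.smul_apply, smul_eq_mul, map_smul, real_inner_smul_left]
    field_simp
  -- Absorbing the factor `ε` into the test leaves noise `ξ` of unit size and the shift `S (ε⁻¹ •
  -- v)`.
  set F : (H → ℝ) → ℝ := fun y => K.toFun (ε • y) with hF
  have hFm : Measurable F := K.measurable.comp hscale
  have hFb : ∀ y, F y ∈ Set.Icc (0 : ℝ) 1 := fun y => K.mem_Icc _
  have hFL : MemLp (fun ω => F fun h => ξ h ω) 2 P := by
    refine MemLp.of_bound (hFm.comp hξm).aestronglyMeasurable 1 (Eventually.of_forall fun ω => ?_)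
    rw [Real.norm_of_nonneg (hFb _).1]
    exact (hFb _).2
  have h0 := hξ.integral_comp_add_le_of_mem_weakClosure hR hRinj hFm hFL hbdd₀ hu₀ ε⁻¹
    (c := errorI P A ξ Θ₀ ε K) (by
      rintro v ⟨x, hx, hxv⟩
      refine le_trans (le_of_eq ?_) (integral_le_errorI hξ.measurable ε K hx)
      simp only [hobs x v hxv, hF])
  -- The lemma passes only upper bounds to the limit, so the power bound on `Λ₁` is used for `-F`.
  have h1 := hξ.integral_comp_add_le_of_mem_weakClosure hR hRinj hFm.neg hFL.neg hbdd₁ hu₁ ε⁻¹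
    (c := errorII P A ξ Θ₁ ε K - 1) (by
      rintro v ⟨x, hx, hxv⟩
      have h2 := integral_le_errorII (A := A) (P := P) hξ.measurable ε K hx
      simp only [hobs x v hxv] at h2
      simp only [Pi.neg_apply, integral_neg, hF]
      linarith)
  simp only [Pi.neg_apply, integral_neg] at h1
  linarith

end Indistinguishable

/-! ### Consistent tests from a separating subspace -/

section Distinguishable

variable {H : Type*} [NormedAddCommGroup H] [InnerProductSpace ℝ H] [CompleteSpace H]
variable {Ω : Type*} [MeasurableSpace Ω] {P : Measure Ω} {R : H →L[ℝ] H} {ξ : H → Ω → ℝ}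

open scoped Classical in
/-- The non-randomized test rejecting the hypothesis if the coordinates `h j` of the observation
lie outside a closed set. -/
noncomputable def coordinateTest {n : ℕ} (h : Fin n → H) (C : Set (Fin n → ℝ)) (hC : IsClosed C) :
    Test H where
  toFun y := Cᶜ.indicator 1 (fun j => y (h j))
  measurable := (measurable_one.indicator hC.measurableSet.compl).comp
    (measurable_pi_lambda _ fun j => measurable_pi_apply (h j))
  mem_Icc y := by
    by_cases hy : (fun j => y (h j)) ∈ Cᶜ <;> simp [hy]

/-- Two bounded sets with a separating subspace are separated, with a margin `δ`, by finitely many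
coordinates `⟪v, S (h j)⟫`, for any `S` with dense range. -/
theorem HasSeparatingSubspace.exists_coordinates {s t : Set H} (hst : HasSeparatingSubspace s t)
    (hs : Bornology.IsBounded s) (ht : Bornology.IsBounded t) {S : H → H} (hS : DenseRange S) :
    ∃ (n : ℕ) (h : Fin n → H) (δ : ℝ) (C D : Set (Fin n → ℝ)), 0 < δ ∧ IsClosed C ∧ Disjoint C D ∧
      (∀ v ∈ s, ∀ y, (∀ j, |y j - ⟪v, S (h j)⟫| ≤ δ) → y ∈ C) ∧
      (∀ v ∈ t, ∀ y, (∀ j, |y j - ⟪v, S (h j)⟫| ≤ δ) → y ∈ D) := by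
  obtain ⟨Γ, hΓ, -, hdisj⟩ := hst
  set n := Module.finrank ℝ Γ
  let b := stdOrthonormalBasis ℝ Γ
  let c : WeakSpace ℝ H → (Fin n → ℝ) := fun v j => ⟪(toWeakSpace ℝ H).symm v, (b j : H)⟫
  have hc : Continuous c := continuous_pi fun j => continuous_inner_weakSpace _
  have hC : IsCompact (c '' closure (toWeakSpace ℝ H '' s)) :=
    (isCompact_closure_toWeakSpace_image hs).image hc
  have hD : IsCompact (c '' closure (toWeakSpace ℝ H '' t)) :=
    (isCompact_closure_toWeakSpace_image ht).image hc
  have hCD : Disjoint (c '' closure (toWeakSpace ℝ H '' s))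
      (c '' closure (toWeakSpace ℝ H '' t)) := by
    rw [Set.disjoint_left]
    rintro _ ⟨u', hu, rfl⟩ ⟨v', hv, huv⟩
    obtain ⟨u, rfl⟩ := (toWeakSpace ℝ H).surjective u'
    obtain ⟨v, rfl⟩ := (toWeakSpace ℝ H).surjective v'
    refine Set.eq_empty_iff_forall_notMem.mp hdisj (Γ.starProjection u) ⟨⟨u, hu, rfl⟩, ⟨v, hv, ?_⟩⟩
    rw [starProjection_eq_iff]
    intro w hw
    have hw' : w = ∑ j, b.repr ⟨w, hw⟩ j • (b j : H) := by
      have := congrArg Subtype.val (b.sum_repr ⟨w, hw⟩)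
      simpa using this.symm
    rw [hw', inner_sum, inner_sum]
    refine Finset.sum_congr rfl fun j _ => ?_
    have hj := congrFun huv j
    simp only [c, LinearEquiv.symm_apply_apply] at hj
    rw [real_inner_smul_right, real_inner_smul_right, hj]
  -- Disjoint compact sets have disjoint closed thickenings; these become the acceptance region `C`
  -- and its counterpart `D`.
  obtain ⟨δ, hδ, hδdisj⟩ := hCD.exists_cthickenings hC hD.isClosed
  obtain ⟨M, hM⟩ := (hs.union ht).exists_norm_le
  set M' := max M 0 + 1
  have hM'pos : 0 < M' := by positivity
  have hM' : ∀ v ∈ s ∪ t, ‖v‖ ≤ M' := fun v hv => by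
    linarith [hM v hv, le_max_left M 0, show M' = max M 0 + 1 from rfl]
  -- The basis vectors need not lie in the range of `S`. Approximating them costs at most `δ / 2` on
  -- vectors of norm at most `M'`, which leaves `δ / 2` for the noise.
  have happrox : ∀ j, ∃ h, ‖S h - b j‖ < δ / (2 * M') := by
    intro j
    obtain ⟨h, hh⟩ := hS.exists_dist_lt (b j : H) (show 0 < δ / (2 * M') by positivity)
    exact ⟨h, by rwa [← dist_eq_norm, dist_comm]⟩
  choose h hh using happrox
  have hclose : ∀ r : Set H, r ⊆ s ∪ t → ∀ v ∈ r, ∀ y : Fin n → ℝ,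
      (∀ j, |y j - ⟪v, S (h j)⟫| ≤ δ / 2) →
        y ∈ Metric.cthickening δ (c '' closure (toWeakSpace ℝ H '' r)) := by
    intro r hr v hv y hy
    refine Metric.mem_cthickening_of_dist_le y (c (toWeakSpace ℝ H v)) δ _
      ⟨_, subset_closure ⟨v, hv, rfl⟩, rfl⟩ ?_
    rw [dist_pi_le_iff hδ.le]
    intro j
    have h1 : |⟪v, S (h j) - b j⟫| ≤ δ / 2 :=
      calc |⟪v, S (h j) - b j⟫| ≤ ‖v‖ * ‖S (h j) - b j‖ := abs_real_inner_le_norm _ _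
        _ ≤ M' * (δ / (2 * M')) := by
          gcongr
          · exact hM' v (hr hv)
          · exact (hh j).le
        _ = δ / 2 := by field_simp
    rw [Real.dist_eq, show y j - c (toWeakSpace ℝ H v) j
      = (y j - ⟪v, S (h j)⟫) + ⟪v, S (h j) - b j⟫ by simp [c, inner_sub_right]]
    exact (abs_add_le _ _).trans (by linarith [hy j])
  exact ⟨n, h, δ / 2, _, _, by positivity, Metric.isClosed_cthickening, hδdisj,
    hclose s Set.subset_union_left, hclose t Set.subset_union_right⟩

/-- For `A x = S v` the observed coordinate at `h` is `⟪v, S h⟫ + ε ξ h`, so the test errs only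
where some `|ε ξ (h j)|` exceeds the margin `δ`. -/
theorem distinguishable_of_hasSeparatingSubspace [IsProbabilityMeasure P]
    (hξ : IsGaussianVector R ξ P) (hR : R.IsPositive) (hRinj : Function.Injective R)
    (A : H →ₗ[ℝ] H) {Θ₀ Θ₁ : Set H}
    (hdom₀ : A '' Θ₀ ⊆ Set.range (posSqrt R hR)) (hdom₁ : A '' Θ₁ ⊆ Set.range (posSqrt R hR))
    (hbdd₀ : Bornology.IsBounded (whitenedSet R hR A Θ₀))
    (hbdd₁ : Bornology.IsBounded (whitenedSet R hR A Θ₁))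
    (hsep : HasSeparatingSubspace (whitenedSet R hR A Θ₀) (whitenedSet R hR A Θ₁)) :
    Distinguishable P A ξ Θ₀ Θ₁ := by
  obtain ⟨n, h, δ, C, D, hδ, hC, hCD, hC', hD'⟩ :=
    hsep.exists_coordinates hbdd₀ hbdd₁ (denseRange_posSqrt R hR hRinj)
  set K := coordinateTest h C hC with hK
  -- Chebyshev in pointwise form: where some noise coordinate exceeds `δ`, `ε² N > 1`, so `ε² N`
  -- dominates the error of the test everywhere.
  set N : Ω → ℝ := fun ω => ∑ j, (ξ (h j) ω) ^ 2 / δ ^ 2 with hN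
  have hNint : Integrable N P :=
    integrable_finsetSum _ fun j _ => (hξ.memLp_two (h j)).integrable_sq.div_const _
  have hN0 : ∀ ω, 0 ≤ N ω := fun ω => Finset.sum_nonneg fun j _ => by positivity
  set B := ∫ ω, N ω ∂P with hB
  have hB0 : 0 ≤ B := integral_nonneg hN0
  have hbound : ∀ (ε : ℝ) (ω : Ω), (∀ j, |ε * ξ (h j) ω| ≤ δ) ∨ 1 ≤ ε ^ 2 * N ω := by
    intro ε ω
    by_contra! hcon
    obtain ⟨⟨j, hj⟩, hlt⟩ := hcon
    have h1 : (ξ (h j) ω) ^ 2 / δ ^ 2 ≤ N ω :=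
      Finset.single_le_sum (f := fun j => (ξ (h j) ω) ^ 2 / δ ^ 2)
        (fun j _ => by positivity) (Finset.mem_univ j)
    have h2 : δ ^ 2 < (ε * ξ (h j) ω) ^ 2 := by
      rw [← sq_abs (ε * ξ (h j) ω)]
      gcongr
    have h3 : 1 < ε ^ 2 * ((ξ (h j) ω) ^ 2 / δ ^ 2) := by
      rw [← mul_div_assoc, lt_div_iff₀ (by positivity), one_mul, ← mul_pow]
      exact h2
    have h4 := mul_le_mul_of_nonneg_left h1 (sq_nonneg ε)
    linarith
  have hobs : ∀ x v ε ω, posSqrt R hR v = A x → (∀ j, |ε * ξ (h j) ω| ≤ δ) →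
      ∀ j, |observation A ξ ε x ω (h j) - ⟪v, posSqrt R hR (h j)⟫| ≤ δ := by
    intro x v ε ω hxv hj j
    simpa [observation, ← hxv, posSqrt_inner] using hj j
  have hint : ∀ ε x, Integrable (fun ω => K.toFun (observation A ξ ε x ω)) P := fun ε x =>
    K.integrable_comp (measurable_observation A hξ.measurable ε x)
  have hI : ∀ ε, errorI P A ξ Θ₀ ε K ≤ ε ^ 2 * B := by
    intro ε
    -- The bound must also be nonnegative, because a real supremum over an empty `Θ₀` is `0`.
    refine Real.iSup_le (fun x => ?_) (by positivity)
    obtain ⟨v, hv⟩ := hdom₀ ⟨x, x.2, rfl⟩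
    rw [hB, ← integral_const_mul]
    refine integral_mono (hint ε x) (hNint.const_mul _) fun ω => ?_
    rcases hbound ε ω with hω | hω
    · have hmem := hC' v ⟨x, x.2, hv.symm⟩ (fun j => observation A ξ ε x ω (h j))
        (hobs x v ε ω hv hω)
      have h0 : K.toFun (observation A ξ ε x ω) = 0 := by simp [hK, coordinateTest, hmem]
      simp only [h0]
      exact mul_nonneg (sq_nonneg ε) (hN0 ω)
    · exact (K.mem_Icc _).2.trans hω
  have hII : ∀ ε, errorII P A ξ Θ₁ ε K ≤ ε ^ 2 * B := by
    intro ε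
    refine Real.iSup_le (fun x => ?_) (by positivity)
    obtain ⟨v, hv⟩ := hdom₁ ⟨x, x.2, rfl⟩
    rw [hB, ← integral_const_mul]
    refine integral_mono ((integrable_const 1).sub (hint ε x)) (hNint.const_mul _) fun ω => ?_
    rcases hbound ε ω with hω | hω
    · have hmem := Set.disjoint_right.mp hCD (hD' v ⟨x, x.2, hv.symm⟩
        (fun j => observation A ξ ε x ω (h j)) (hobs x v ε ω hv hω))
      have h0 : K.toFun (observation A ξ ε x ω) = 1 := by simp [hK, coordinateTest, hmem]
      simp only [h0, sub_self]
      exact mul_nonneg (sq_nonneg ε) (hN0 ω)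
    · have := (K.mem_Icc (observation A ξ ε x ω)).1
      beta_reduce
      linarith
  intro α hα _
  -- The level is required for every `ε > 0`. When `ε² B ≥ α` the test that never rejects secures
  -- it; this does not affect the limit of the type II error as `ε → 0`.
  let K₀ : Test H := ⟨fun _ => 0, measurable_const, fun _ => by simp⟩
  classical
  refine ⟨fun ε => if ε ^ 2 * B < α then K else K₀, fun ε _ => ?_, ?_⟩
  · beta_reduce
    split_ifs with hε
    · exact (hI ε).trans_lt hε
    · refine lt_of_le_of_lt (Real.iSup_le (fun x => ?_) le_rfl) hα
      simp [K₀]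
  · have hlim : Tendsto (fun ε : ℝ => ε ^ 2 * B) (𝓝[>] 0) (𝓝 0) := by
      have : Continuous fun ε : ℝ => ε ^ 2 * B := by fun_prop
      simpa using (this.tendsto 0).mono_left nhdsWithin_le_nhds
    refine squeeze_zero' (Eventually.of_forall fun ε => ?_) ?_ hlim
    · refine Real.iSup_nonneg fun x => integral_nonneg fun ω => ?_
      simpa using (Test.mem_Icc _ _).2
    · filter_upwards [hlim.eventually_lt_const hα] with ε hε
      rw [if_pos hε]
      exact hII ε

end Distinguishable

/-! ### The dichotomy -/

theorem theorem2p12 {H : Type*} [NormedAddCommGroup H] [InnerProductSpace ℝ H] [CompleteSpace H]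
    {Ω : Type*} [MeasurableSpace Ω] (P : Measure Ω) [IsProbabilityMeasure P]
    (A : H →ₗ[ℝ] H) (hA : Function.Injective A)
    (R : H →L[ℝ] H) (hR : R.IsPositive) (hRinj : Function.Injective R)
    (ξ : H → Ω → ℝ) (hξ : IsGaussianVector R ξ P)
    (Θ : Submodule ℝ H) (hΘ : IsClosed (Θ : Set H))
    (Θ₀ Θ₁ : Set H) (hΘ₀ : Θ₀ ⊆ Θ) (hΘ₁ : Θ₁ ⊆ Θ)
    -- `R^{-1/2}` is defined on the sets `A Θ₀` and `A Θ₁`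
    (hdom₀ : A '' Θ₀ ⊆ Set.range (posSqrt R hR)) (hdom₁ : A '' Θ₁ ⊆ Set.range (posSqrt R hR))
    (hbdd₀ : Bornology.IsBounded (whitenedSet R hR A Θ₀))
    (hbdd₁ : Bornology.IsBounded (whitenedSet R hR A Θ₁)) :
    (¬ HasSeparatingSubspace (whitenedSet R hR A Θ₀) (whitenedSet R hR A Θ₁) →
        Indistinguishable P A ξ Θ₀ Θ₁) ∧
      (HasSeparatingSubspace (whitenedSet R hR A Θ₀) (whitenedSet R hR A Θ₁) →
        Distinguishable P A ξ Θ₀ Θ₁) := by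

  refine ⟨fun h => ?_,
    distinguishable_of_hasSeparatingSubspace hξ hR hRinj A hdom₀ hdom₁ hbdd₀ hbdd₁⟩
  obtain ⟨u, hu₀, hu₁⟩ := exists_mem_weakClosure_inter hbdd₀ hbdd₁ h
  exact indistinguishable_of_mem_weakClosure_inter hξ hR hRinj A hbdd₀ hbdd₁ hu₀ hu₁
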